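/- Let $q$ be a prime power, let $\mathbb F_q$ be the finite field with $q$ elements and let $n\ge 0$ be an integer. For a map $T:\mathbb F_q^n\to\mathbb F_q^n$, its functional graph is the directed graph with vertex set $\mathbb F_q^n$ and edges $v\to T(v)$ for $v\in\mathbb F_q^n$. Let $B_q(n)$ be the number of isomorphism classes of functional graphs of bijective $\mathbb F_q$-linear maps $T:\mathbb F_q^n\to\mathbb F_q^n$, and for $i\ge 1$ let $\sigma_i$ be the number of positive divisors of $q^i-1$. Then $$B_q(n)\le \sum_{\lambda\vdash n}\ \prod_{i=1}^n\binom{\sigma_i+\lambda_i-1}{\lambda_i},$$ where the sum is over all partitions $\lambda$ of $n$, written as vectors $\lambda=(\lambda_1,\dots,\lambda_n)$ of nonnegative integers with $\sum_{i=1}^n i\,\lambda_i=n$ (so $\lambda_i$ is the number of parts equal to $i$). -/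

import Mathlib

/-- Two directed graphs are isomorphic if some bijection of their vertex sets preserves and
reflects adjacency. -/
def digraphIso {V W : Type*} (G : Digraph V) (H : Digraph W) : Prop :=
  Nonempty (G.Adj ≃r H.Adj)

/-- Isomorphism, as an equivalence relation on the directed graphs with vertex set `V`. -/
def digraphIsoSetoid (V : Type*) : Setoid (Digraph V) where
  r G H := digraphIso G H
  iseqv :=
    { refl := fun G => ⟨RelIso.refl G.Adj⟩
      symm := fun ⟨e⟩ => ⟨e.symm⟩
      trans := fun ⟨e⟩ ⟨f⟩ => ⟨e.trans f⟩ }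

/-- The functional graph of a self-map `T` of `V`: its edges are `v → T v`, for `v` in `V`. -/
def functionalGraph {V : Type*} (T : V → V) : Digraph V where
  Adj v w := T v = w

/-- The set of isomorphism classes of the functional graphs of the bijective `F`-linear maps
from `F^n` to itself. -/
def bijLinearGraphClasses (F : Type*) [Field F] (n : ℕ) :
    Set (Quotient (digraphIsoSetoid (Fin n → F))) :=
  {c | ∃ T : (Fin n → F) →ₗ[F] (Fin n → F), Function.Bijective T ∧
    c = Quotient.mk (digraphIsoSetoid (Fin n → F)) (functionalGraph T)}

/-- The number of non-isomorphic functional graphs of bijective `F`-linear maps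
from `F^n` to itself. -/
noncomputable def numBijLinearGraphs (F : Type*) [Field F] (n : ℕ) : ℕ :=
  (bijLinearGraphClasses F n).ncard

/-- The number of positive divisors of `q ^ i - 1`. -/
def numDivisors (q i : ℕ) : ℕ := (q ^ i - 1).divisors.card

/-!
The conjugacy class of a permutation of a finite set, hence its functional graph up to isomorphism,
is determined by the numbers of fixed points of its powers. A bijective linear map `T` of a space
`V` over the field with `q` elements makes `V` a sum of blocks `F[X] ⧸ (p ^ k)` with `p`
irreducible, and `T ^ j` fixes `q ^ (deg p * min k m)` points of such a block, where `m` is the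
multiplicity of `p` in `X ^ j - 1`. If `e` is the multiplicative order of a root of `p`, then `m`
depends only on `e` and `j`, and `deg p` is the order of `q` modulo `e`. So the isomorphism class is
determined by the multiset of the pairs `(k * deg p, e)`: a partition of `dim V` in which each part
`i` is labelled by a divisor of `q ^ i - 1`.
-/

open Function Polynomial

theorem sum_divisors_mul_count (s : Multiset ℕ) {j : ℕ} (hj : j ≠ 0) :
    ∑ d ∈ j.divisors, d * s.count d = (s.filter (· ∣ j)).sum := by
  rw [Finset.sum_multiset_count_of_subset (s.filter (· ∣ j)) j.divisors fun d hd => by simp_all]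
  refine Finset.sum_congr rfl fun d hd => ?_
  rw [Multiset.count_filter_of_pos (p := (· ∣ j)) (Nat.dvd_of_mem_divisors hd), smul_eq_mul,
    mul_comm]

theorem multiset_eq_of_sum_filter_dvd_eq {s t : Multiset ℕ} (hs : 0 ∉ s) (ht : 0 ∉ t)
    (h : ∀ j ≠ 0, (s.filter (· ∣ j)).sum = (t.filter (· ∣ j)).sum) : s = t := by
  ext j
  induction j using Nat.strong_induction_on with
  | _ j ih =>
    rcases eq_or_ne j 0 with rfl | hj
    · rw [Multiset.count_eq_zero_of_notMem hs, Multiset.count_eq_zero_of_notMem ht]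
    · have hproper : ∑ d ∈ j.properDivisors, d * s.count d =
          ∑ d ∈ j.properDivisors, d * t.count d :=
        Finset.sum_congr rfl fun d hd => by rw [ih d (Nat.mem_properDivisors.1 hd).2]
      have hall := h j hj
      rw [← sum_divisors_mul_count s hj, ← sum_divisors_mul_count t hj,
        ← Nat.cons_self_properDivisors hj, Finset.sum_cons, Finset.sum_cons, hproper] at hall
      exact Nat.eq_of_mul_eq_mul_left (Nat.pos_of_ne_zero hj) (Nat.add_right_cancel hall)

section Permutations

open Equiv.Perm

variable {α : Type*} [Fintype α] [DecidableEq α] (σ : Equiv.Perm α)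

theorem filter_support_pow_apply_eq (j : ℕ) :
    {x ∈ σ.support | (σ ^ j) x = x} =
      {c ∈ σ.cycleFactorsFinset | c.support.card ∣ j}.biUnion support := by
  ext x
  simp only [Finset.mem_filter, Finset.mem_biUnion]
  constructor
  · rintro ⟨hx, hj⟩
    have hxc : x ∈ (σ.cycleOf x).support := mem_support_cycleOf_iff.2 ⟨.refl _ _, hx⟩
    exact ⟨σ.cycleOf x, ⟨cycleOf_mem_cycleFactorsFinset_iff.2 hx,
      ((isCycleOn_support_cycleOf σ x).pow_apply_eq hxc).1 hj⟩, hxc⟩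
  · rintro ⟨c, ⟨hc, hj⟩, hx⟩
    obtain rfl := cycle_is_cycleOf hx hc
    exact ⟨mem_cycleFactorsFinset_support_le hc hx,
      ((isCycleOn_support_cycleOf σ x).pow_apply_eq hx).2 hj⟩

theorem card_filter_support_pow_apply_eq (j : ℕ) :
    Finset.card {x ∈ σ.support | (σ ^ j) x = x} = (σ.cycleType.filter (· ∣ j)).sum := by
  rw [filter_support_pow_apply_eq, Finset.card_biUnion, cycleType_def, Multiset.filter_map]
  · rfl
  · intro c hc d hd hcd
    exact (σ.cycleFactorsFinset_pairwise_disjoint (Finset.mem_filter.1 hc).1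
      (Finset.mem_filter.1 hd).1 hcd).disjoint_support

theorem ncard_ptsOfPeriod_eq_card_compl_support_add (j : ℕ) :
    (ptsOfPeriod σ j).ncard = σ.supportᶜ.card + (σ.cycleType.filter (· ∣ j)).sum := by
  have hpts : ptsOfPeriod σ j = ↑(σ.supportᶜ ∪ {x ∈ σ.support | (σ ^ j) x = x}) := by
    ext x
    by_cases hx : σ x = x <;>
      simp [IsPeriodicPt, IsFixedPt, hx, iterate_fixed, ← Equiv.Perm.coe_pow]
  rw [hpts, Set.ncard_coe_finset, Finset.card_union_of_disjoint
    (disjoint_compl_left.mono_right (Finset.filter_subset _ _)), card_filter_support_pow_apply_eq]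

end Permutations

theorem isConj_of_ncard_ptsOfPeriod_eq {α : Type*} [Finite α] {σ τ : Equiv.Perm α}
    (h : ∀ j ≠ 0, (ptsOfPeriod σ j).ncard = (ptsOfPeriod τ j).ncard) : IsConj σ τ := by
  classical
  have := Fintype.ofFinite α
  have hzero (ρ : Equiv.Perm α) : 0 ∉ ρ.cycleType := fun h0 => by
    simpa using Equiv.Perm.two_le_of_mem_cycleType h0
  have hone (ρ : Equiv.Perm α) : ρ.cycleType.filter (· ∣ 1) = 0 := by
    refine Multiset.filter_eq_nil.2 fun m hm hm1 => ?_
    exact (Equiv.Perm.one_lt_of_mem_cycleType hm).ne' (Nat.dvd_one.1 hm1)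
  have hsum := h
  simp only [ncard_ptsOfPeriod_eq_card_compl_support_add] at hsum
  have hfixed : σ.supportᶜ.card = τ.supportᶜ.card := by
    simpa only [hone, Multiset.sum_zero, add_zero] using hsum 1 one_ne_zero
  refine Equiv.Perm.isConj_of_cycleType_eq
    (multiset_eq_of_sum_filter_dvd_eq (hzero σ) (hzero τ) fun j hj => ?_)
  exact Nat.add_left_cancel (hfixed ▸ hsum j hj)

theorem digraphIso_functionalGraph_of_semiconj {V W : Type*} {f : V → V} {g : W → W} (e : V ≃ W)
    (h : Semiconj e f g) : digraphIso (functionalGraph f) (functionalGraph g) :=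
  ⟨⟨e, fun {a b} => by simp only [functionalGraph, ← h.eq, e.injective.eq_iff]⟩⟩

theorem digraphIso_functionalGraph_of_ncard_ptsOfPeriod_eq {α : Type*} [Finite α] {f g : α → α}
    (hf : Bijective f) (hg : Bijective g)
    (h : ∀ j ≠ 0, (ptsOfPeriod f j).ncard = (ptsOfPeriod g j).ncard) :
    digraphIso (functionalGraph f) (functionalGraph g) := by
  have hconj : IsConj (Equiv.ofBijective f hf) (Equiv.ofBijective g hg) :=
    isConj_of_ncard_ptsOfPeriod_eq h
  obtain ⟨e, he⟩ := isConj_iff.1 hconj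
  exact digraphIso_functionalGraph_of_semiconj e fun x =>
    Equiv.congr_fun (mul_inv_eq_iff_eq_mul.1 he) x

theorem card_ker_eq_card_quotient_range {R M : Type*} [Ring R] [AddCommGroup M] [Module R M]
    [Finite M] (f : M →ₗ[R] M) : Nat.card f.ker = Nat.card (M ⧸ f.range) := by
  refine Nat.eq_of_mul_eq_mul_right (Nat.card_pos (α := f.range)) ?_
  calc Nat.card f.ker * Nat.card f.range
      = Nat.card f.ker * Nat.card (M ⧸ f.ker) := by
        rw [Nat.card_congr f.quotKerEquivRange.toEquiv]
    _ = Nat.card f.range * Nat.card (M ⧸ f.range) := by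
        rw [← Submodule.card_eq_card_quotient_mul_card, ← Submodule.card_eq_card_quotient_mul_card]
    _ = Nat.card (M ⧸ f.range) * Nat.card f.range := mul_comm _ _

section Quotient

variable {R : Type*} [CommRing R]

theorem card_torsionBy_quotient (I : Ideal R) [Finite (R ⧸ I)] (b : R) :
    Nat.card (Submodule.torsionBy R (R ⧸ I) b) = Nat.card (R ⧸ I ⊔ Ideal.span {b}) := by
  have hrange : (DistribSMul.toLinearMap R (R ⧸ I) b).range =
      Submodule.map I.mkQ (Ideal.span {b}) := by
    rw [Ideal.span, Submodule.map_span, Set.image_singleton]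
    ext x
    rw [Submodule.mem_span_singleton]
    constructor
    · rintro ⟨x, rfl⟩
      obtain ⟨r, rfl⟩ := Ideal.Quotient.mk_surjective x
      exact ⟨r, by simp [Algebra.smul_def, mul_comm]⟩
    · rintro ⟨r, rfl⟩
      exact ⟨Ideal.Quotient.mk I r, by simp [Algebra.smul_def, mul_comm]⟩
  rw [Submodule.torsionBy, card_ker_eq_card_quotient_range, hrange]
  exact Nat.card_congr (Submodule.quotientQuotientEquivQuotientSup _ _).toEquiv

theorem span_pow_sup_span_pow_mul {p v : R} (h : IsCoprime p v) (k m : ℕ) :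
    Ideal.span {p ^ k} ⊔ Ideal.span {p ^ m * v} = Ideal.span {p ^ min k m} := by
  refine le_antisymm (sup_le ?_ ?_) ?_
  · exact Ideal.span_singleton_le_span_singleton.2 (pow_dvd_pow p (min_le_left k m))
  · exact Ideal.span_singleton_le_span_singleton.2
      ((pow_dvd_pow p (min_le_right k m)).mul_right v)
  · rw [Ideal.span_singleton_le_iff_mem, ← Ideal.span_insert, Ideal.mem_span_pair]
    rcases le_total k m with hkm | hmk
    · exact ⟨1, 0, by rw [min_eq_left hkm]; ring⟩
    · obtain ⟨a, b, hab⟩ := h.pow_left (m := k)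
      refine ⟨a * p ^ m, b, ?_⟩
      rw [min_eq_right hmk]
      linear_combination p ^ m * hab

theorem card_torsionBy_quotient_span_pow [IsDomain R] [IsPrincipalIdealRing R] {p f : R}
    (hp : Irreducible p) {m : ℕ} (hm : emultiplicity p f = m) (k : ℕ)
    [Finite (R ⧸ Ideal.span {p ^ k})] :
    Nat.card (Submodule.torsionBy R (R ⧸ Ideal.span {p ^ k}) f) =
      Nat.card (R ⧸ Ideal.span {p ^ min k m}) := by
  have hfin := finiteMultiplicity_of_emultiplicity_eq_natCast hm
  obtain ⟨v, hf, hv⟩ := hfin.exists_eq_pow_mul_and_not_dvd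
  rw [multiplicity_eq_of_emultiplicity_eq_some hm] at hf
  rw [card_torsionBy_quotient, hf, span_pow_sup_span_pow_mul (hp.coprime_iff_not_dvd.2 hv)]

end Quotient

section RootOrder

open AdjoinRoot

theorem dvd_X_pow_sub_one_iff_orderOf_root_dvd {R : Type*} [CommRing R] (p : R[X]) (j : ℕ) :
    p ∣ X ^ j - 1 ↔ orderOf (root p) ∣ j := by
  rw [← AdjoinRoot.mk_eq_zero, map_sub, map_pow, mk_X, map_one, sub_eq_zero,
    orderOf_dvd_iff_pow_eq_one]

variable {F : Type*} [Field F] {p : F[X]}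

/-- The multiplicity in `X ^ j - 1`, over a field of characteristic `c` and for `j ≠ 0`, of an
irreducible polynomial whose roots have multiplicative order `e`. For the polynomial `X`, whose root
is `0`, the convention `orderOf 0 = 0` gives the correct multiplicity `0`. -/
def orderMultiplicity (c e j : ℕ) : ℕ := if e ∣ j then c ^ j.factorization c else 0

theorem emultiplicity_X_pow_sub_one (c : ℕ) [hc : Fact c.Prime] [CharP F c] (hp : Irreducible p)
    {j : ℕ} (hj : j ≠ 0) :
    emultiplicity p (X ^ j - 1 : F[X]) = orderMultiplicity c (orderOf (root p)) j := by
  rw [orderMultiplicity]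
  split_ifs with hdvd
  · set t := c ^ j.factorization c
    set m := j / t
    have hpow : (X ^ j - 1 : F[X]) = (X ^ m - 1) ^ t := by
      rw [sub_pow_char_pow, one_pow, ← pow_mul, mul_comm, Nat.ordProj_mul_ordCompl_eq_self]
    have hsep : (X ^ m - 1 : F[X]).Separable := X_pow_sub_one_separable_iff.2 fun hm =>
      Nat.not_dvd_ordCompl hc.out hj ((CharP.cast_eq_zero_iff F c m).1 hm)
    have hpm : p ∣ X ^ m - 1 := by
      rw [← dvd_X_pow_sub_one_iff_orderOf_root_dvd, hpow] at hdvd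
      exact hp.prime.dvd_of_dvd_pow hdvd
    have hone : emultiplicity p (X ^ m - 1 : F[X]) = 1 :=
      (emultiplicity_le_one_of_separable hp.not_isUnit hsep).antisymm
        (Order.one_le_iff_pos.2 (emultiplicity_pos_of_dvd hpm))
    rw [hpow, emultiplicity_pow hp.prime, hone, mul_one]
  · rw [Nat.cast_zero, emultiplicity_eq_zero, dvd_X_pow_sub_one_iff_orderOf_root_dvd]
    exact hdvd

theorem finite_quotient_span_singleton [Finite F] (hp : p ≠ 0) :
    Finite (F[X] ⧸ Ideal.span {p}) :=
  have : Module.Finite F (F[X] ⧸ Ideal.span {p}) := (powerBasis hp).finite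
  Module.finite_of_finite F

variable [Fintype F]

theorem card_quotient_span_singleton (hp : p ≠ 0) :
    Nat.card (F[X] ⧸ Ideal.span {p}) = Fintype.card F ^ p.natDegree := by
  have : Module.Finite F (F[X] ⧸ Ideal.span {p}) := (powerBasis hp).finite
  rw [Module.natCard_eq_pow_finrank (K := F), finrank_quotient_span_eq_natDegree,
    Nat.card_eq_fintype_card]

theorem orderOf_root_dvd_card_pow_natDegree_sub_one (hp : Irreducible p)
    (h : orderOf (root p) ≠ 0) :
    orderOf (root p) ∣ Fintype.card F ^ p.natDegree - 1 := by
  have : Fact (Irreducible p) := ⟨hp⟩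
  have : Finite (AdjoinRoot p) := finite_quotient_span_singleton hp.ne_zero
  have := Fintype.ofFinite (AdjoinRoot p)
  have hcard : Fintype.card (AdjoinRoot p) = Fintype.card F ^ p.natDegree := by
    rw [← Nat.card_eq_fintype_card, ← card_quotient_span_singleton hp.ne_zero, AdjoinRoot]
  have hroot : root p ≠ 0 := fun h0 => h (by rw [h0, orderOf_zero])
  rw [← hcard, orderOf_dvd_iff_pow_eq_one]
  exact FiniteField.pow_card_sub_one_eq_one _ hroot

theorem natDegree_eq_orderOf_card (hp : Irreducible p) (h : orderOf (root p) ≠ 0) :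
    p.natDegree = orderOf (Fintype.card F : ZMod (orderOf (root p))) := by
  have : Fact (Irreducible p) := ⟨hp⟩
  obtain ⟨c, _⟩ := CharP.exists F
  obtain ⟨f, hc, hf⟩ := FiniteField.card F c
  have : Fact c.Prime := ⟨hc⟩
  have hcop : c.Coprime (orderOf (root p)) := by
    rw [hc.coprime_iff_not_dvd]
    intro hce
    have hsub := hce.trans (orderOf_root_dvd_card_pow_natDegree_sub_one hp h)
    have hpow : c ∣ Fintype.card F ^ p.natDegree :=
      dvd_pow (hf ▸ dvd_pow_self c f.ne_zero) hp.natDegree_pos.ne'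
    exact hc.not_dvd_one <|
      (Nat.dvd_sub_iff_right (Nat.one_le_pow _ _ Fintype.card_pos) hpow).1 hsub
  have hcyc : p ∣ cyclotomic (orderOf (root p)) F := by
    rw [← AdjoinRoot.mk_eq_zero, ← aeval_eq]
    have := (IsPrimitiveRoot.orderOf (root p)).isRoot_cyclotomic (Nat.pos_of_ne_zero h)
    rwa [IsRoot.def, ← map_cyclotomic _ (algebraMap F _), eval_map_algebraMap] at this
  rw [natDegree_of_dvd_cyclotomic_of_irreducible hf hcop hcyc hp, ← orderOf_units,
    ZMod.coe_unitOfCoprime, hf]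

/-- The dimension of the kernel of `X ^ j - 1` on `F[X] ⧸ (p ^ k)`, where `F` is a field with `q`
elements and characteristic `c` and `p ≠ X` is irreducible, in terms of the pair
`x = (deg p * k, e)`, with `e` the multiplicative order of a root of `p`. The degree of `p` is
recovered from `x` as the order of `q` modulo `e`. -/
noncomputable def fixedDim (q c j : ℕ) (x : ℕ × ℕ) : ℕ :=
  orderOf (q : ZMod x.2) * min (x.1 / orderOf (q : ZMod x.2)) (orderMultiplicity c x.2 j)

theorem card_torsionBy_X_pow_sub_one (c : ℕ) [Fact c.Prime] [CharP F c] (hp : Irreducible p)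
    (h : orderOf (root p) ≠ 0) (k : ℕ) {j : ℕ} (hj : j ≠ 0) :
    Nat.card (Submodule.torsionBy F[X] (F[X] ⧸ Ideal.span {p ^ k}) (X ^ j - 1)) =
      Fintype.card F ^ fixedDim (Fintype.card F) c j (p.natDegree * k, orderOf (root p)) := by
  have := finite_quotient_span_singleton (pow_ne_zero k hp.ne_zero)
  rw [card_torsionBy_quotient_span_pow hp (emultiplicity_X_pow_sub_one c hp hj),
    card_quotient_span_singleton (pow_ne_zero _ hp.ne_zero), natDegree_pow, fixedDim,
    ← natDegree_eq_orderOf_card hp h, Nat.mul_div_cancel_left _ hp.natDegree_pos, mul_comm]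

end RootOrder

section LinearMaps

theorem card_torsionBy_eq_prod {R M ι : Type*} [CommRing R] [AddCommGroup M] [Module R M]
    [Fintype ι] {N : ι → Type*} [∀ i, AddCommGroup (N i)] [∀ i, Module R (N i)]
    (E : M ≃ₗ[R] ∀ i, N i) (a : R) :
    Nat.card (Submodule.torsionBy R M a) = ∏ i, Nat.card (Submodule.torsionBy R (N i) a) := by
  have hmem (x : M) : x ∈ Submodule.torsionBy R M a ↔
      ∀ i, E x i ∈ Submodule.torsionBy R (N i) a := by
    simp only [Submodule.mem_torsionBy_iff]
    rw [← E.map_eq_zero_iff, map_smul, funext_iff]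
    rfl
  rw [← Nat.card_pi]
  exact Nat.card_congr ((E.toEquiv.subtypeEquiv hmem).trans Equiv.subtypePiEquivPi)

variable {F V : Type*} [Field F] [AddCommGroup V] [Module F V] (T : V →ₗ[F] V)

theorem X_pow_sub_one_smul_eq_zero_iff (j : ℕ) (x : V) :
    (X ^ j - 1 : F[X]) • Module.AEval'.of T x = 0 ↔ x ∈ ptsOfPeriod T j := by
  rw [sub_smul, one_smul, Module.AEval'.X_pow_smul_of, sub_eq_zero,
    (Module.AEval'.of T).injective.eq_iff, Module.End.smul_def, Module.End.pow_apply]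
  rfl

theorem ncard_ptsOfPeriod_eq_card_torsionBy (j : ℕ) :
    (ptsOfPeriod T j).ncard =
      Nat.card (Submodule.torsionBy F[X] (Module.AEval' T) (X ^ j - 1)) := by
  rw [← Nat.card_coe_set_eq]
  exact Nat.card_congr ((Module.AEval'.of T).toEquiv.subtypeEquiv fun x =>
    (X_pow_sub_one_smul_eq_zero_iff T j x).symm)

variable {T}

theorem exists_isTorsionBy_X_pow_sub_one [Finite V] (hT : Bijective T) :
    ∃ j ≠ 0, Module.IsTorsionBy F[X] (Module.AEval' T) (X ^ j - 1 : F[X]) := by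
  refine ⟨orderOf (Equiv.ofBijective T hT), (orderOf_pos _).ne', fun {y} => ?_⟩
  obtain ⟨x, rfl⟩ := (Module.AEval'.of T).surjective y
  rw [X_pow_sub_one_smul_eq_zero_iff]
  have hpow := Equiv.congr_fun (pow_orderOf_eq_one (Equiv.ofBijective T hT)) x
  rwa [Equiv.Perm.coe_pow] at hpow

variable {ι : Type*} {p : ι → F[X]} {k : ι → ℕ}

theorem orderOf_root_ne_zero_of_bijective [Finite V] (hT : Bijective T)
    (E : Module.AEval' T ≃ₗ[F[X]] ∀ i, F[X] ⧸ Ideal.span {p i ^ k i}) {i : ι} (hk : k i ≠ 0) :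
    orderOf (AdjoinRoot.root (p i)) ≠ 0 := by
  classical
  obtain ⟨j, hj, htors⟩ := exists_isTorsionBy_X_pow_sub_one hT
  have hsmul : 
      (X ^ j - 1 : F[X]) • (Submodule.Quotient.mk 1 : F[X] ⧸ Ideal.span {p i ^ k i}) = 0 := by
    have := congr_arg E (htors (x := E.symm (Pi.single i (Submodule.Quotient.mk 1))))
    rw [map_smul, LinearEquiv.apply_symm_apply, map_zero] at this
    simpa only [Pi.smul_apply, Pi.single_eq_same, Pi.zero_apply] using congr_fun this i
  have hdvd : p i ^ k i ∣ X ^ j - 1 := by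
    rwa [← Submodule.Quotient.mk_smul, Submodule.Quotient.mk_eq_zero, Ideal.mem_span_singleton,
      smul_eq_mul, mul_one] at hsmul
  exact ne_zero_of_dvd_ne_zero hj <|
    (dvd_X_pow_sub_one_iff_orderOf_root_dvd _ _).1 ((dvd_pow_self _ hk).trans hdvd)

theorem finrank_eq_sum_natDegree_mul [Finite F] [Fintype ι] [Module.Finite F V]
    (hp : ∀ i, Irreducible (p i))
    (E : Module.AEval' T ≃ₗ[F[X]] ∀ i, F[X] ⧸ Ideal.span {p i ^ k i}) :
    Module.finrank F V = ∑ i, (p i).natDegree * k i := by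
  have := Fintype.ofFinite F
  have hcard : Nat.card V = ∏ i, Nat.card (F[X] ⧸ Ideal.span {p i ^ k i}) := by
    rw [← Nat.card_pi, Nat.card_congr ((Module.AEval'.of T).toEquiv.trans E.toEquiv)]
  simp_rw [card_quotient_span_singleton (pow_ne_zero _ (hp _).ne_zero), natDegree_pow,
    Finset.prod_pow_eq_pow_sum] at hcard
  rw [Module.natCard_eq_pow_finrank (K := F), Nat.card_eq_fintype_card] at hcard
  simpa only [mul_comm] using Nat.pow_right_injective Fintype.one_lt_card hcard

theorem exists_multiset_ncard_ptsOfPeriod_eq [Fintype F] (c : ℕ) [Fact c.Prime] [CharP F c]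
    [Module.Finite F V] (hT : Bijective T) :
    ∃ S : Multiset (ℕ × ℕ), (∀ x ∈ S, x.1 ≠ 0 ∧ x.2 ∣ Fintype.card F ^ x.1 - 1) ∧
      (S.map Prod.fst).sum = Module.finrank F V ∧ ∀ j ≠ 0, (ptsOfPeriod T j).ncard =
        Fintype.card F ^ (S.map (fixedDim (Fintype.card F) c j)).sum := by
  classical
  have : Finite V := Module.finite_of_finite F
  obtain ⟨ι, _, p, hp, k, ⟨E⟩⟩ := Module.equiv_directSum_of_isTorsion
    (Module.AEval.isTorsion_of_finiteDimensional F V T)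
  replace E := E.trans (DirectSum.linearEquivFunOnFintype F[X] ι _)
  have horder {i : ι} (hk : k i ≠ 0) := orderOf_root_ne_zero_of_bijective hT E hk
  let label (i : ι) : ℕ × ℕ := ((p i).natDegree * k i, orderOf (AdjoinRoot.root (p i)))
  refine ⟨(Finset.univ.filter (k · ≠ 0)).val.map label, ?_, ?_, fun j hj => ?_⟩
  · simp only [Multiset.mem_map, Finset.mem_val, Finset.mem_filter_univ]
    rintro _ ⟨i, hk, rfl⟩
    refine ⟨mul_ne_zero (hp i).natDegree_pos.ne' hk, ?_⟩
    exact (orderOf_root_dvd_card_pow_natDegree_sub_one (hp i) (horder hk)).trans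
      (Nat.pow_sub_one_dvd_pow_sub_one _ (dvd_mul_right _ _))
  · rw [finrank_eq_sum_natDegree_mul hp E, Multiset.map_map]
    exact Finset.sum_filter_of_ne fun i _ => right_ne_zero_of_mul
  · rw [ncard_ptsOfPeriod_eq_card_torsionBy, card_torsionBy_eq_prod E, Multiset.map_map]
    change _ = _ ^ ∑ i with k i ≠ 0, fixedDim _ c j (label i)
    rw [← Finset.prod_pow_eq_pow_sum, Finset.prod_filter]
    refine Finset.prod_congr rfl fun i _ => ?_
    split_ifs with hk
    · exact card_torsionBy_X_pow_sub_one c (hp i) (horder hk) (k i) hj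
    · have : Subsingleton (F[X] ⧸ Ideal.span {p i ^ k i}) := by
        rw [Ideal.Quotient.subsingleton_iff, not_not.1 hk, pow_zero, Ideal.span_singleton_one]
      exact Nat.card_unique

end LinearMaps

theorem exists_sym_map_mk_eq_filter {ι α : Type*} [DecidableEq ι] {S : Multiset (ι × α)} {i : ι}
    {s : Finset α} (hs : ∀ x ∈ S, x.1 = i → x.2 ∈ s) :
    ∃ m : Sym s ((S.map Prod.fst).count i),
      m.1.map (fun a : s => (i, (a : α))) = S.filter (·.1 = i) := by
  have hs' : ∀ x ∈ S.filter (·.1 = i), x.2 ∈ s := fun x hx =>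
    hs x (Multiset.mem_filter.1 hx).1 (Multiset.mem_filter.1 hx).2
  let m : Multiset s := (S.filter (·.1 = i)).pmap (fun x hx => ⟨x.2, hx⟩) hs'
  have hm : m.map (fun a : s => (i, (a : α))) = S.filter (·.1 = i) := by
    rw [Multiset.map_pmap]
    refine (Multiset.pmap_eq_map _ (fun x => (i, x.2)) _ hs').trans ?_
    refine (Multiset.map_congr rfl fun x hx => ?_).trans (Multiset.map_id _)
    exact Prod.ext (Multiset.mem_filter.1 hx).2.symm rfl
  refine ⟨⟨m, ?_⟩, hm⟩
  rw [Multiset.card_pmap, Multiset.count_map]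
  simp only [eq_comm]

/-- A partition of `n` in which each part `i` carries a label from `L i`, parts of the same size
being interchangeable: the labels of the parts equal to `i` form a multiset. -/
abbrev LabeledPartition {α : Type*} (L : ℕ → Finset α) (n : ℕ) : Type _ :=
  (lam : n.Partition) × ∀ i : Finset.Icc 1 n, Sym (L i) (lam.parts.count ↑i)

namespace LabeledPartition

variable {α : Type*} {L : ℕ → Finset α} {n : ℕ}

theorem card_eq (L : ℕ → Finset α) (n : ℕ) :
    Nat.card (LabeledPartition L n) = ∑ lam : n.Partition, ∏ i ∈ Finset.Icc 1 n,
      ((L i).card + lam.parts.count i - 1).choose (lam.parts.count i) := by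
  classical
  rw [Nat.card_sigma]
  refine Finset.sum_congr rfl fun lam _ => ?_
  rw [Nat.card_pi, ← Finset.prod_coe_sort (Finset.Icc 1 n)]
  refine Finset.prod_congr rfl fun i _ => ?_
  rw [Nat.card_eq_fintype_card, Sym.card_sym_eq_choose, Fintype.card_coe]

/-- The multiset of the pairs (part, label) of a labelled partition. -/
def toMultiset (s : LabeledPartition L n) : Multiset (ℕ × α) :=
  ∑ i : Finset.Icc 1 n, (s.2 i).1.map fun a : L i => ((i : ℕ), (a : α))

theorem exists_toMultiset_eq {S : Multiset (ℕ × α)} (hS : ∀ x ∈ S, x.1 ≠ 0 ∧ x.2 ∈ L x.1)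
    (hn : (S.map Prod.fst).sum = n) : ∃ s : LabeledPartition L n, s.toMultiset = S := by
  classical
  let lam : n.Partition :=
    { parts := S.map Prod.fst
      parts_pos := by
        intro i hi
        obtain ⟨x, hx, rfl⟩ := Multiset.mem_map.1 hi
        exact Nat.pos_of_ne_zero (hS x hx).1
      parts_sum := hn }
  have hlabels (i : Finset.Icc 1 n) : ∃ m : Sym (L i) (lam.parts.count ↑i),
      m.1.map (fun a : L i => ((i : ℕ), (a : α))) = S.filter (·.1 = (i : ℕ)) :=
    exists_sym_map_mk_eq_filter fun x hx hi => hi ▸ (hS x hx).2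
  choose labels hlabels using hlabels
  refine ⟨⟨lam, labels⟩, ?_⟩
  have hmem {x : ℕ × α} (hx : x ∈ S) : x.1 ∈ Finset.Icc 1 n :=
    Finset.mem_Icc.2 ⟨Nat.one_le_iff_ne_zero.2 (hS x hx).1,
      hn ▸ Multiset.single_le_sum (fun _ _ => Nat.zero_le _) _ (Multiset.mem_map_of_mem _ hx)⟩
  ext x
  simp only [toMultiset, hlabels, Multiset.count_sum', Multiset.count_filter]
  rw [Finset.sum_coe_sort (Finset.Icc 1 n) fun i => if x.1 = i then S.count x else 0,
    Finset.sum_ite_eq]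
  split_ifs with hx
  · rfl
  · exact (Multiset.count_eq_zero_of_notMem fun h => hx (hmem h)).symm

end LabeledPartition

theorem exists_labeledPartition_ncard_ptsOfPeriod_eq {F V : Type*} [Field F] [Fintype F]
    [AddCommGroup V] [Module F V] [Module.Finite F V] {T : V →ₗ[F] V} (hT : Bijective T)
    (c : ℕ) [Fact c.Prime] [CharP F c] :
    ∃ s : LabeledPartition (fun i => (Fintype.card F ^ i - 1).divisors) (Module.finrank F V),
      ∀ j ≠ 0, (ptsOfPeriod T j).ncard =
        Fintype.card F ^ (s.toMultiset.map (fixedDim (Fintype.card F) c j)).sum := by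
  obtain ⟨S, hS, hn, hcard⟩ := exists_multiset_ncard_ptsOfPeriod_eq c hT
  obtain ⟨s, rfl⟩ := LabeledPartition.exists_toMultiset_eq
    (L := fun i => (Fintype.card F ^ i - 1).divisors) (fun x hx => ⟨(hS x hx).1,
      Nat.mem_divisors.2 ⟨(hS x hx).2,
        Nat.sub_ne_zero_of_lt (Nat.one_lt_pow (hS x hx).1 Fintype.one_lt_card)⟩⟩) hn
  exact ⟨s, hcard⟩

theorem lemma3p1 (q : ℕ) (F : Type*) [Field F] [Fintype F] (hq : Fintype.card F = q) (n : ℕ) :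
    numBijLinearGraphs F n ≤
      ∑ lam : n.Partition, ∏ i ∈ Finset.Icc 1 n,
        (numDivisors q i + lam.parts.count i - 1).choose (lam.parts.count i) := by
  subst hq
  obtain ⟨c, _⟩ := CharP.exists F
  have : Fact c.Prime := ⟨CharP.char_is_prime F c⟩
  choose T hT hclass using fun C : bijLinearGraphClasses F n => C.2
  choose s hs using fun C => exists_labeledPartition_ncard_ptsOfPeriod_eq (hT C) c
  have hinj : Injective s := fun C D hCD => by
    have hiso := digraphIso_functionalGraph_of_ncard_ptsOfPeriod_eq (hT C) (hT D) fun j hj => by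
      rw [hs C j hj, hs D j hj, hCD]
    exact Subtype.ext <| (hclass C).trans <| (Quotient.sound hiso).trans (hclass D).symm
  rw [numBijLinearGraphs, ← Nat.card_coe_set_eq]
  refine (Nat.card_le_card_of_injective s hinj).trans_eq ?_
  rw [LabeledPartition.card_eq, Module.finrank_fin_fun]
  rfl
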